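/- Let $\mathcal{L}(V)$ and $\mathcal{L}(E)$ be complete Heyting algebras. A \emph{(directed) fuzzy graph} consists of a set $V$ of vertices, a set $E$ of edges, functions $s,t : E \to V$ (source and target), and membership functions $\alpha_V : V \to \mathcal{L}(V)$ and $\alpha_E : E \to \mathcal{L}(E)$. A homomorphism from one fuzzy graph to another, the latter with membership functions $\beta_V,\beta_E$, is a pair $(f_V, f_E)$ of functions on vertices and on edges that commutes with sources and targets and satisfies $\alpha_V \le \beta_V f_V$ and $\alpha_E \le \beta_E f_E$ pointwise. An \emph{undirected fuzzy graph} is a fuzzy graph together with a function $\mathsf{sym} : E \to E$ such that $\mathsf{sym}\cdot\mathsf{sym} = \mathrm{id}_E$, $s\cdot\mathsf{sym} = t$ and $t\cdot\mathsf{sym} = s$ (no compatibility of $\alpha_E$ with $\mathsf{sym}$ is required); its homomorphisms must moreover commute with $\mathsf{sym}$. A directed or undirected fuzzy graph is \emph{simple} if it has no parallel edges, i.e. any two edges with the same source and the same target are equal (loops are allowed). A \emph{quasitopos} is a category that has all finite limits and finite colimits, has a regular-subobject classifier (a monomorphism $\mathrm{True} : 1 \to \Omega$ from a terminal object such that every regular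 monomorphism $m : A \to B$ is the pullback of $\mathrm{True}$ along a unique morphism $\chi : B \to \Omega$), and is locally cartesian closed (every slice category is cartesian closed). Corollary (Directed and undirected simple fuzzy graphs form quasitoposes). The category of directed simple fuzzy graphs and the category of undirected simple fuzzy graphs, i.e. the full subcategories of the categories of directed, respectively undirected, fuzzy graphs on the simple ones, are quasitoposes. -/

import Mathlib

universe w₁ w₂ u v u'

open CategoryTheory CategoryTheory.Limits

/-- A regular-subobject classifier: a monomorphism `truth : 1 ⟶ Ω` out of a terminal object such
that every regular monomorphism `m : A ⟶ B` is the pullback of `truth` along a unique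
`χ : B ⟶ Ω`. -/
structure RegularSubobjectClassifier (C : Type u') [Category.{v} C] where
  one : C
  isTerminal : IsTerminal one
  Ω : C
  truth : one ⟶ Ω
  mono_truth : Mono truth
  existsUnique_χ : ∀ {A B : C} (m : A ⟶ B), IsRegularMono m →
    ∃! χ : B ⟶ Ω, IsPullback m (isTerminal.from A) χ truth

/-- Cartesian closed: finite products exist, and taking the product with any fixed object has a
right adjoint. -/
def IsCartesianClosed (C : Type u') [Category.{v} C] : Prop :=
  ∃ _ : CartesianMonoidalCategory C, Nonempty (MonoidalClosed C)

/-- Locally cartesian closed: every slice category is cartesian closed. -/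
def IsLocallyCartesianClosed (C : Type u') [Category.{v} C] : Prop :=
  ∀ X : C, IsCartesianClosed (Over X)

/-- A quasitopos: finite limits and colimits exist, there is a regular-subobject classifier, and
the category is locally cartesian closed. -/
structure IsQuasitopos (C : Type u') [Category.{v} C] : Prop where
  hasFiniteLimits : HasFiniteLimits C
  hasFiniteColimits : HasFiniteColimits C
  hasClassifier : Nonempty (RegularSubobjectClassifier C)
  isLocallyCartesianClosed : IsLocallyCartesianClosed C

/-- A (directed) fuzzy graph: a directed multigraph with a membership function on its vertices
and one on its edges. -/
structure FuzzyGraph (LV : Type w₁) (LE : Type w₂) where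
  V : Type u
  E : Type u
  src : E → V
  tgt : E → V
  memV : V → LV
  memE : E → LE

namespace FuzzyGraph

variable {LV : Type w₁} {LE : Type w₂} [Preorder LV] [Preorder LE]

/-- A homomorphism of fuzzy graphs: a graph homomorphism that does not decrease memberships. -/
@[ext]
structure Hom (A B : FuzzyGraph.{w₁, w₂, u} LV LE) where
  onV : A.V → B.V
  onE : A.E → B.E
  src_onE : ∀ e, B.src (onE e) = onV (A.src e)
  tgt_onE : ∀ e, B.tgt (onE e) = onV (A.tgt e)
  memV_le : ∀ x, A.memV x ≤ B.memV (onV x)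
  memE_le : ∀ e, A.memE e ≤ B.memE (onE e)

instance : Category.{u} (FuzzyGraph.{w₁, w₂, u} LV LE) where
  Hom := Hom
  id A :=
    { onV := fun x => x
      onE := fun e => e
      src_onE := fun _ => rfl
      tgt_onE := fun _ => rfl
      memV_le := fun _ => le_rfl
      memE_le := fun _ => le_rfl }
  comp f g :=
    { onV := fun x => g.onV (f.onV x)
      onE := fun e => g.onE (f.onE e)
      src_onE := fun e => by rw [g.src_onE, f.src_onE]
      tgt_onE := fun e => by rw [g.tgt_onE, f.tgt_onE]
      memV_le := fun x => (f.memV_le x).trans (g.memV_le _)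
      memE_le := fun e => (f.memE_le e).trans (g.memE_le _) }

/-- A fuzzy graph is simple if it has no parallel edges (loops are allowed). -/
def IsSimple : ObjectProperty (FuzzyGraph.{w₁, w₂, u} LV LE) :=
  fun A => ∀ e e' : A.E, A.src e = A.src e' → A.tgt e = A.tgt e' → e = e'

end FuzzyGraph

/-- The category of directed simple fuzzy graphs, as a full subcategory of fuzzy graphs. -/
abbrev SimpleFuzzyGraph (LV : Type w₁) (LE : Type w₂) [Preorder LV] [Preorder LE] :=
  (FuzzyGraph.IsSimple (LV := LV) (LE := LE) :
    ObjectProperty (FuzzyGraph.{w₁, w₂, u} LV LE)).FullSubcategory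

/-- An undirected fuzzy graph: each edge `e` comes with an edge `sym e` in the opposite direction,
`sym` being an involution. The membership functions are arbitrary functions. -/
structure UndirectedFuzzyGraph (LV : Type w₁) (LE : Type w₂)
    extends FuzzyGraph.{w₁, w₂, u} LV LE where
  sym : E → E
  sym_sym : ∀ e, sym (sym e) = e
  src_sym : ∀ e, src (sym e) = tgt e
  tgt_sym : ∀ e, tgt (sym e) = src e

namespace UndirectedFuzzyGraph

variable {LV : Type w₁} {LE : Type w₂} [Preorder LV] [Preorder LE]

/-- A homomorphism of undirected fuzzy graphs: a homomorphism of the underlying fuzzy graphs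
that commutes with `sym`. -/
@[ext]
structure Hom (A B : UndirectedFuzzyGraph.{w₁, w₂, u} LV LE)
    extends FuzzyGraph.Hom A.toFuzzyGraph B.toFuzzyGraph where
  onE_sym : ∀ e, onE (A.sym e) = B.sym (onE e)

instance : Category.{u} (UndirectedFuzzyGraph.{w₁, w₂, u} LV LE) where
  Hom := Hom
  id A :=
    { toHom := 𝟙 A.toFuzzyGraph
      onE_sym := fun _ => rfl }
  comp {A B C} f g :=
    { toHom := CategoryStruct.comp (X := A.toFuzzyGraph) (Y := B.toFuzzyGraph)
        (Z := C.toFuzzyGraph) f.toHom g.toHom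
      onE_sym := fun e => (congrArg g.onE (f.onE_sym e)).trans (g.onE_sym _) }

/-- An undirected fuzzy graph is simple if it has no parallel edges (loops are allowed). -/
def IsSimple : ObjectProperty (UndirectedFuzzyGraph.{w₁, w₂, u} LV LE) :=
  fun A => FuzzyGraph.IsSimple A.toFuzzyGraph

end UndirectedFuzzyGraph

/-- The category of undirected simple fuzzy graphs, as a full subcategory of undirected fuzzy
graphs. -/
abbrev UndirectedSimpleFuzzyGraph (LV : Type w₁) (LE : Type w₂) [Preorder LV] [Preorder LE] :=
  (UndirectedFuzzyGraph.IsSimple (LV := LV) (LE := LE) :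
    ObjectProperty (UndirectedFuzzyGraph.{w₁, w₂, u} LV LE)).FullSubcategory

/-!
Membership functions play no role in the underlying sets of the universal constructions: a simple
fuzzy graph is a set `V` of vertices with a unary relation with values in `LV` (the membership of
vertices) and a binary relation with values in `WithBot LE`, which sends `(x, y)` to the membership
of the unique edge from `x` to `y`, or to the adjoined bottom element if there is none
(`FuzzyGraph.adjacency`). A homomorphism is then just a map of vertices that does not decrease the
two relations. Since adjoining a bottom element to a frame gives a frame, directed simple fuzzy
graphs are the structures for a signature of relations valued in frames. Undirected simple ones
are those in which `(y, x)` has a value other than bottom whenever `(x, y)` does: the involution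
`sym` is determined by simplicity. Both cases are covered by `FuzzyStructure`, whose symmetry
condition only refers to a `threshold`, which is `⊥` (no condition) or an atom of the frame.

It remains to see that structures for a signature form a quasitopos. Limits and colimits are those
of sets, with the initial and final relations, given by infima and suprema. The classifier is the
set of truth values with all relations constantly `⊤`, because the regular monomorphisms are the
injections that preserve truth values exactly. The exponential of `A` and `B` over `X` consists of
the functions between fibres, with relations given by the infimum of the implications
`A.rel x ⇨ B.rel (φ x)`, cut off by the relation of `X`. The symmetry condition survives each
construction because an element `t` which is `⊥` or an atom satisfies `t ≤ ⨆ v` only if `t ≤ v`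
for a member of the family or `t = ⊥`, and `t ≤ v ⇨ w` as soon as `t ≤ v` implies `t ≤ w`
(`FuzzySignature.threshold_le_iSup`, `FuzzySignature.threshold_le_himp`).

Being a quasitopos is invariant under equivalence (`IsQuasitopos.of_equivalence`).
-/

universe v₂ u₂ a b c

/-! ### Cartesian closed categories, and transport along equivalences -/


section Transport

variable {C : Type u'} [Category.{v} C] {D : Type u₂} [Category.{v₂} D]

open MonoidalCategory CartesianMonoidalCategory in
/-- A category with a terminal object and a choice `fan` of binary products is cartesian closed as
soon as every pair `A`, `B` has an exponential `(E, ev)`. The universal property is stated without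
mentioning the functoriality of the product: the morphism `h` ranges over the (unique) morphism
`A × Y ⟶ A × E` with components the identity and `g`. -/
theorem IsCartesianClosed.of_exponentials {T : D} (hT : IsTerminal T)
    (fan : ∀ A B : D, BinaryFan A B) (isLimit : ∀ A B, IsLimit (fan A B))
    (exp : ∀ A B : D, ∃ (E : D) (ev : (fan A E).pt ⟶ B), ∀ (Y : D) (f : (fan A Y).pt ⟶ B),
      ∃! g : Y ⟶ E, ∀ h : (fan A Y).pt ⟶ (fan A E).pt,
        h ≫ (fan A E).fst = (fan A Y).fst → h ≫ (fan A E).snd = (fan A Y).snd ≫ g →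
          h ≫ ev = f) :
    IsCartesianClosed D := by
  let _ : CartesianMonoidalCategory D := .ofChosenFiniteProducts
    ⟨asEmptyCone T, hT⟩ fun A B => ⟨fan A B, isLimit A B⟩
  have adj (A : D) : (tensorLeft A).IsLeftAdjoint := by
    have (B : D) : HasTerminal (CostructuredArrow (tensorLeft A) B) := by
      obtain ⟨E, ev, huniv⟩ := exp A B
      let t : CostructuredArrow (tensorLeft A) B := CostructuredArrow.mk (Y := E) ev
      have key (s : CostructuredArrow (tensorLeft A) B) (g : s.left ⟶ E) :
          (∀ h : (fan A s.left).pt ⟶ (fan A E).pt,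
            h ≫ (fan A E).fst = (fan A s.left).fst →
            h ≫ (fan A E).snd = (fan A s.left).snd ≫ g → h ≫ ev = s.hom) ↔
          (A ◁ g) ≫ ev = s.hom := by
        refine ⟨fun H => H (A ◁ g) (whiskerLeft_fst A g) (whiskerLeft_snd A g), ?_⟩
        intro H h h₁ h₂
        have : h = A ◁ g := BinaryFan.IsLimit.hom_ext (isLimit A E)
          (h₁.trans (whiskerLeft_fst A g).symm) (h₂.trans (whiskerLeft_snd A g).symm)
        rw [this]; exact H
      have ht : IsTerminal t := by
        choose g hg hg' using fun s : CostructuredArrow (tensorLeft A) B => huniv s.left s.hom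
        refine IsTerminal.ofUniqueHom
          (fun s => CostructuredArrow.homMk (g s) ((key s _).1 (hg s))) fun s m => ?_
        ext
        exact hg' s m.left ((key s _).2 (CostructuredArrow.w m))
      exact ht.hasTerminal
    exact isLeftAdjoint_of_costructuredArrowTerminals _
  exact ⟨inferInstance, ⟨⟨fun A => ⟨_, Adjunction.ofIsLeftAdjoint (tensorLeft A)⟩⟩⟩⟩

theorem IsCartesianClosed.of_equivalence (e : C ≌ D) (h : IsCartesianClosed D) :
    IsCartesianClosed C := by
  obtain ⟨_, ⟨_⟩⟩ := h
  have : HasFiniteProducts C :=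
    ⟨fun _ => Adjunction.hasLimitsOfShape_of_equivalence e.functor⟩
  let _ : CartesianMonoidalCategory C := .ofHasFiniteProducts
  exact ⟨inferInstance, ⟨cartesianClosedOfEquiv e.symm⟩⟩

theorem IsLocallyCartesianClosed.of_equivalence (e : C ≌ D) (h : IsLocallyCartesianClosed D) :
    IsLocallyCartesianClosed C :=
  fun X => (h (e.functor.obj X)).of_equivalence (Over.postEquiv X e)

theorem isRegularMono_map_of_equivalence (e : C ≌ D) {A B : C} (m : A ⟶ B)
    (hm : IsRegularMono m) : IsRegularMono (e.functor.map m) :=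
  ⟨⟨{ Z := _
      left := e.functor.map (IsRegularMono.left m)
      right := e.functor.map (IsRegularMono.right m)
      w := by rw [← Functor.map_comp, IsRegularMono.w, Functor.map_comp]
      isLimit := isLimitForkMapOfIsLimit e.functor _ (IsRegularMono.isLimit m) }⟩⟩

/-- The classifying morphism of `m` is the adjoint transpose of that of its image under the
equivalence; pullback squares are transferred by pasting with unit and counit. -/
theorem RegularSubobjectClassifier.of_equivalence (e : C ≌ D)
    (h : Nonempty (RegularSubobjectClassifier D)) : Nonempty (RegularSubobjectClassifier C) := by
  obtain ⟨K⟩ := h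
  have := K.mono_truth
  refine ⟨{
    one := e.inverse.obj K.one
    isTerminal := K.isTerminal.isTerminalObj e.inverse K.one
    Ω := e.inverse.obj K.Ω
    truth := e.inverse.map K.truth
    mono_truth := inferInstance
    existsUnique_χ := fun {A B} m hm => ?_ }⟩
  have := isRegularMono_map_of_equivalence e m hm
  obtain ⟨χ, hχ, huniq⟩ := K.existsUnique_χ (e.functor.map m) this
  have hT := K.isTerminal.isTerminalObj e.inverse K.one
  refine ⟨e.unit.app B ≫ e.inverse.map χ, ?_, fun χ' hχ' => ?_⟩
  · have sq : IsPullback m (e.unit.app A) (e.unit.app B) (e.inverse.map (e.functor.map m)) :=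
      (IsPullback.of_horiz_isIso ⟨(e.unit.naturality m).symm⟩).flip
    have h := sq.paste_vert (hχ.map e.inverse)
    rw [hT.hom_ext (e.unit.app A ≫ e.inverse.map (K.isTerminal.from _))
      ((K.isTerminal.isTerminalObj e.inverse K.one).from A)] at h
    exact h
  · have sq : IsPullback (e.functor.map (e.inverse.map K.truth)) (e.counit.app K.one)
        (e.counit.app K.Ω) K.truth :=
      IsPullback.of_vert_isIso ⟨by simp⟩
    have h := (hχ'.map e.functor).paste_vert sq
    rw [K.isTerminal.hom_ext (_ ≫ e.counit.app K.one) (K.isTerminal.from _)] at h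
    rw [← huniq _ h]
    simp

theorem IsQuasitopos.of_equivalence (e : C ≌ D) (h : IsQuasitopos D) : IsQuasitopos C where
  hasFiniteLimits :=
    have := h.hasFiniteLimits
    ⟨fun _ _ _ => Adjunction.hasLimitsOfShape_of_equivalence e.functor⟩
  hasFiniteColimits :=
    have := h.hasFiniteColimits
    ⟨fun _ _ _ => Adjunction.hasColimitsOfShape_of_equivalence e.functor⟩
  hasClassifier := RegularSubobjectClassifier.of_equivalence e h.hasClassifier
  isLocallyCartesianClosed := h.isLocallyCartesianClosed.of_equivalence e

end Transport

/-! ### Structures with frame-valued relations -/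


/-- A signature for relational structures with truth values in frames. Each relation symbol has an
arity and a frame of truth values; moreover it carries an involution of its arity and a
`threshold`, an element which is either `⊥` or an atom of the frame, used to impose the symmetry
condition in `FuzzyStructure.symm`. (With `threshold = ⊥` the condition is void.) -/
structure FuzzySignature where
  Symbol : Type a
  arity : Symbol → Type b
  Value : Symbol → Type c
  [frame : ∀ i, Order.Frame (Value i)]
  perm : ∀ i, arity i → arity i
  perm_perm : ∀ i k, perm i (perm i k) = k
  threshold : ∀ i, Value i
  threshold_inf : ∀ i v, threshold i ⊓ v = ⊥ ∨ threshold i ≤ v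

namespace FuzzySignature

attribute [instance] FuzzySignature.frame

variable {S : FuzzySignature.{a, b, c}} {i : S.Symbol}

/-- As the threshold is `⊥` or an atom, `threshold ⊓ v` is either `⊥` or the threshold. -/
theorem threshold_le_himp {v w : S.Value i} (h : S.threshold i ≤ v → S.threshold i ≤ w) :
    S.threshold i ≤ v ⇨ w := by
  rw [le_himp_iff]
  rcases S.threshold_inf i v with hv | hv
  · simp [hv]
  · exact inf_le_left.trans (h hv)

/-- An atom of a frame is completely prime. If the threshold is `⊥` the conclusion is trivial, also
for an empty family. -/
theorem threshold_le_iSup {κ : Sort*} {v : κ → S.Value i} {w : S.Value i}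
    (hle : S.threshold i ≤ ⨆ k, v k) (h : ∀ k, S.threshold i ≤ v k → S.threshold i ≤ w) :
    S.threshold i ≤ w := by
  by_cases hk : ∃ k, S.threshold i ≤ v k
  · exact h _ hk.choose_spec
  · push Not at hk
    rw [← inf_eq_left.2 hle, inf_iSup_eq]
    exact iSup_le fun k => ((S.threshold_inf i (v k)).resolve_right (hk k)).trans_le bot_le

end FuzzySignature

/-- A structure for a fuzzy signature: a set with a family of frame-valued relations. For each
relation, the set of tuples whose truth value is above the threshold is closed under the
permutation of coordinates given by the signature. -/
structure FuzzyStructure (S : FuzzySignature.{a, b, c}) where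
  carrier : Type u
  rel : ∀ i, (S.arity i → carrier) → S.Value i
  symm : ∀ i x, S.threshold i ≤ rel i x → S.threshold i ≤ rel i fun k => x (S.perm i k)

namespace FuzzyStructure

variable {S : FuzzySignature.{a, b, c}}

/-- A homomorphism is a map that does not decrease the truth values. -/
@[ext]
structure Hom (A B : FuzzyStructure.{u} S) where
  toFun : A.carrier → B.carrier
  rel_le : ∀ i x, A.rel i x ≤ B.rel i fun k => toFun (x k)

instance : Category.{u} (FuzzyStructure.{u} S) where
  Hom := Hom
  id A := ⟨fun x => x, fun _ _ => le_rfl⟩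
  comp f g := ⟨fun x => g.toFun (f.toFun x), fun i x => (f.rel_le i x).trans (g.rel_le i _)⟩

@[ext]
theorem hom_ext {A B : FuzzyStructure.{u} S} {f g : A ⟶ B} (h : ∀ x, f.toFun x = g.toFun x) :
    f = g :=
  Hom.ext (funext h)

theorem congr_toFun {A B : FuzzyStructure.{u} S} {f g : A ⟶ B} (h : f = g) (x : A.carrier) :
    f.toFun x = g.toFun x := by rw [h]

variable (S) in
/-- The underlying-set functor. -/
def forgetful : FuzzyStructure.{u} S ⥤ Type u where
  obj A := A.carrier
  map f := TypeCat.ofHom f.toFun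

instance : (forgetful.{u} S).Faithful where
  map_injective h := hom_ext fun x => ConcreteCategory.congr_hom h x

/-! ### Limits and colimits -/

/-- The structure induced on a set by a family of maps out of it into structures. -/
def initial {κ : Type*} (B : κ → FuzzyStructure.{u} S) (X : Type u)
    (f : ∀ j, X → (B j).carrier) : FuzzyStructure.{u} S where
  carrier := X
  rel i x := ⨅ j, (B j).rel i fun k => f j (x k)
  symm i x h := by
    rw [le_iInf_iff] at h ⊢
    exact fun j => (B j).symm i _ (h j)

/-- The structure induced on a set by a family of maps from structures into it. -/
def final {κ : Type*} (B : κ → FuzzyStructure.{u} S) (X : Type u)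
    (f : ∀ j, (B j).carrier → X) : FuzzyStructure.{u} S where
  carrier := X
  rel i x := ⨆ (j) (y : {y : S.arity i → (B j).carrier // ∀ k, f j (y k) = x k}), (B j).rel i y.1
  symm i x h := by
    refine S.threshold_le_iSup h fun j hj => S.threshold_le_iSup hj fun y hy => ?_
    exact ((B j).symm i _ hy).trans <| le_iSup_of_le j <|
      le_iSup_of_le ⟨fun k => y.1 (S.perm i k), fun k => y.2 _⟩ le_rfl

section Limits

variable {J : Type*} [Category J] {F : J ⥤ FuzzyStructure.{u} S}

/-- A cone on underlying sets, with the initial structure on its point. -/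
def coneOfForgetful (t : Cone (F ⋙ forgetful S)) : Cone F where
  pt := initial F.obj t.pt fun j => t.π.app j
  π :=
    { app j := ⟨t.π.app j, fun _ _ => iInf_le _ j⟩
      naturality _ _ φ := hom_ext fun x => ConcreteCategory.congr_hom (t.π.naturality φ) x }

/-- A cocone on underlying sets, with the final structure on its point. -/
def coconeOfForgetful (t : Cocone (F ⋙ forgetful S)) : Cocone F where
  pt := final F.obj t.pt fun j => t.ι.app j
  ι :=
    { app j := ⟨t.ι.app j, fun _ x => le_iSup_of_le j <| le_iSup_of_le ⟨x, fun _ => rfl⟩ le_rfl⟩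
      naturality _ _ φ := hom_ext fun x => ConcreteCategory.congr_hom (t.ι.naturality φ) x }

/-- The underlying-set functor lifts limits: equip the limit with the initial structure. -/
def isLimitConeOfForgetful {t : Cone (F ⋙ forgetful S)} (ht : IsLimit t) :
    IsLimit (coneOfForgetful t) :=
  IsLimit.ofFaithful (forgetful S) ht
    (fun s => ⟨ht.lift ((forgetful S).mapCone s), fun i x => le_iInf fun j => by
      refine ((s.π.app j).rel_le i x).trans_eq (congrArg _ (funext fun k => ?_))
      exact (ConcreteCategory.congr_hom (ht.fac ((forgetful S).mapCone s) j) (x k)).symm⟩)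
    fun _ => rfl

/-- The underlying-set functor lifts colimits: equip the colimit with the final structure. -/
def isColimitCoconeOfForgetful {t : Cocone (F ⋙ forgetful S)} (ht : IsColimit t) :
    IsColimit (coconeOfForgetful t) :=
  IsColimit.ofFaithful (forgetful S) ht
    (fun s => ⟨ht.desc ((forgetful S).mapCocone s), fun i x => iSup_le fun j => iSup_le fun y => by
      refine ((s.ι.app j).rel_le i y.1).trans_eq (congrArg _ (funext fun k => ?_))
      rw [← y.2 k]
      exact (ConcreteCategory.congr_hom (ht.fac ((forgetful S).mapCocone s) j) (y.1 k)).symm⟩)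
    fun _ => rfl

end Limits

instance : HasFiniteLimits (FuzzyStructure.{u} S) :=
  ⟨fun _ _ _ => ⟨fun _ => ⟨_, isLimitConeOfForgetful (limit.isLimit _)⟩⟩⟩

instance : HasFiniteColimits (FuzzyStructure.{u} S) :=
  ⟨fun _ _ _ => ⟨fun _ => ⟨_, isColimitCoconeOfForgetful (colimit.isColimit _)⟩⟩⟩

/-! ### The regular-subobject classifier -/

/-- The structure on a set in which all relations are constantly `⊤`. -/
def codiscrete (X : Type u) : FuzzyStructure.{u} S where
  carrier := X
  rel _ _ := ⊤
  symm _ _ _ := le_top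

/-- Every map into a codiscrete structure is a homomorphism. -/
def toCodiscrete {A : FuzzyStructure.{u} S} {X : Type u} (f : A.carrier → X) :
    A ⟶ codiscrete X :=
  ⟨f, fun _ _ => le_top⟩

/-- The structure with one element and all relations constantly `⊥`. -/
def point : FuzzyStructure.{u} S where
  carrier := PUnit
  rel _ _ := ⊥
  symm _ _ h := h

/-- The structure `point` represents the underlying-set functor. -/
def pointTo {A : FuzzyStructure.{u} S} (x : A.carrier) : point ⟶ A :=
  ⟨fun _ => x, fun _ _ => bot_le⟩

def isTerminalCodiscretePUnit : IsTerminal (codiscrete PUnit : FuzzyStructure.{u} S) :=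
  IsTerminal.ofUniqueHom (fun _ => toCodiscrete fun _ => PUnit.unit) fun _ _ => rfl

/-- The substructure on a subset, with the restricted relations. -/
def restrict (B : FuzzyStructure.{u} S) (p : B.carrier → Prop) : FuzzyStructure.{u} S where
  carrier := {x // p x}
  rel i x := B.rel i fun k => (x k).1
  symm i _ h := B.symm i _ h

/-- A regular monomorphism is an injection which preserves truth values exactly. -/
theorem injective_and_rel_le_of_isRegularMono {A B : FuzzyStructure.{u} S} (m : A ⟶ B)
    (hm : IsRegularMono m) : Function.Injective m.toFun ∧
      ∀ i x, B.rel i (fun k => m.toFun (x k)) ≤ A.rel i x := by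
  -- `m` is compared with the restriction of `B` to the set on which the two arrows agree.
  let E := B.restrict fun y =>
    (IsRegularMono.left m).toFun y = (IsRegularMono.right m).toFun y
  let ι : E ⟶ B := ⟨Subtype.val, fun _ _ => le_rfl⟩
  let k : E ⟶ A := IsRegularMono.lift m ι (hom_ext fun y => y.2)
  have hk : k ≫ m = ι := IsRegularMono.fac m ι _
  have hw := congr_toFun (IsRegularMono.w m)
  have : Mono m := (IsRegularMono.getStruct m).mono
  let m' : A ⟶ E := ⟨fun x => ⟨m.toFun x, hw x⟩, m.rel_le⟩
  have hm' : m' ≫ k = 𝟙 A := by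
    rw [← cancel_mono m, Category.assoc, hk]
    rfl
  have hm'' := congr_toFun hm'
  refine ⟨fun _ _ hxy => ?_, fun i x => ?_⟩
  · refine (hm'' _).symm.trans (Eq.trans ?_ (hm'' _))
    exact congrArg k.toFun (Subtype.ext hxy)
  · refine (k.rel_le i fun j => ⟨m.toFun (x j), hw (x j)⟩).trans_eq ?_
    exact congrArg _ (funext fun j => hm'' (x j))

variable (S) in
/-- The classifier is the codiscrete structure on the set of truth values. -/
theorem nonempty_regularSubobjectClassifier :
    Nonempty (RegularSubobjectClassifier (FuzzyStructure.{u} S)) := by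
  let truth : (codiscrete PUnit : FuzzyStructure.{u} S) ⟶ codiscrete (ULift.{u} Prop) :=
    toCodiscrete fun _ => ⟨True⟩
  refine ⟨{
    one := codiscrete PUnit
    isTerminal := isTerminalCodiscretePUnit
    Ω := codiscrete (ULift.{u} Prop)
    truth := truth
    mono_truth := ⟨fun _ _ _ => hom_ext fun _ => rfl⟩
    existsUnique_χ := fun {A B} m hm => ?_ }⟩
  obtain ⟨hinj, hrel⟩ := injective_and_rel_le_of_isRegularMono m hm
  let χ₀ : B ⟶ codiscrete (ULift.{u} Prop) := toCodiscrete fun y => ⟨∃ x, m.toFun x = y⟩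
  refine ⟨χ₀, ?_, fun χ hχ => ?_⟩
  · have hs (s : PullbackCone χ₀ truth) (z) :
        ∃ x, m.toFun x = s.fst.toFun z :=
      of_eq_true (congrArg ULift.down (congr_toFun s.condition z))
    choose l hl using hs
    refine ⟨⟨hom_ext fun x => ULift.ext _ _ (eq_true ⟨x, rfl⟩)⟩,
      ⟨PullbackCone.IsLimit.mk _ (fun s => ⟨l s, fun i z => ?_⟩) (fun s => hom_ext (hl s))
        (fun _ => rfl) fun s _ h _ => hom_ext fun z =>
          hinj ((congr_toFun h z).trans (hl s z).symm)⟩⟩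
    refine ((s.fst.rel_le i z).trans_eq (congrArg _ (funext fun k => ?_))).trans (hrel i _)
    exact (hl s (z k)).symm
  -- Uniqueness is tested on points: `y` is classified by `True` exactly if it factors through `m`.
  · refine hom_ext fun y => ULift.ext _ _ (propext ⟨fun hy => ?_, ?_⟩)
    · have hy' : pointTo y ≫ χ = toCodiscrete (fun _ => PUnit.unit) ≫ truth :=
        hom_ext fun _ => ULift.ext _ _ (eq_true hy)
      exact ⟨(hχ.lift _ _ hy').toFun PUnit.unit,
        congr_toFun (hχ.lift_fst _ _ hy') PUnit.unit⟩
    · rintro ⟨x, rfl⟩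
      exact of_eq_true (congrArg ULift.down (congr_toFun hχ.w x))

end FuzzyStructure

namespace FuzzyStructure

variable {S : FuzzySignature.{a, b, c}}

/-! ### Exponentials in the slices -/

section Slice

variable {X : FuzzyStructure.{u} S}

theorem over_w {A B : Over X} (f : A ⟶ B) (x : A.left.carrier) :
    B.hom.toFun (f.left.toFun x) = A.hom.toFun x :=
  congr_toFun (Over.w f) x

/-- The fibre product of two structures over `X`. -/
def fibreProduct (A B : Over X) : FuzzyStructure.{u} S where
  carrier := {p : A.left.carrier × B.left.carrier // A.hom.toFun p.1 = B.hom.toFun p.2}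
  rel i p := (A.left.rel i fun k => (p k).1.1) ⊓ B.left.rel i fun k => (p k).1.2
  symm i _ h := le_inf (A.left.symm i _ (h.trans inf_le_left))
    (B.left.symm i _ (h.trans inf_le_right))

/-- The product in the slice over `X`, given by the fibre product. -/
def overFan (A B : Over X) : BinaryFan A B :=
  let p : fibreProduct A B ⟶ A.left := ⟨fun p => p.1.1, fun _ _ => inf_le_left⟩
  let q : fibreProduct A B ⟶ B.left := ⟨fun p => p.1.2, fun _ _ => inf_le_right⟩
  BinaryFan.mk (P := Over.mk (p ≫ A.hom)) (Over.homMk p)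
    (Over.homMk q (hom_ext fun x => x.2.symm))

def isLimitOverFan (A B : Over X) : IsLimit (overFan A B) :=
  BinaryFan.IsLimit.mk _
    (fun f g => Over.homMk
      ⟨fun x => ⟨(f.left.toFun x, g.left.toFun x), (over_w f x).trans (over_w g x).symm⟩,
        fun i x => le_inf (f.left.rel_le i x) (g.left.rel_le i x)⟩
      (hom_ext fun x => over_w f x))
    (fun _ _ => rfl) (fun _ _ => rfl)
    fun f g m hf hg => by
      subst hf hg
      rfl

/-- The exponential in the slice over `X`: its elements over `x` are the functions from the fibre
of `A` over `x` to the fibre of `B` over `x`. The truth value of a relation at a tuple of such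
functions is the degree to which the functions, evaluated along tuples of `A`, preserve the
relation. -/
def sliceExp (A B : Over X) : FuzzyStructure.{u} S where
  carrier := Σ x : X.carrier, {y // A.hom.toFun y = x} → {z // B.hom.toFun z = x}
  rel i e := (X.rel i fun k => (e k).1) ⊓
    ⨅ y : {y : S.arity i → A.left.carrier // ∀ k, A.hom.toFun (y k) = (e k).1},
      A.left.rel i y.1 ⇨ B.left.rel i fun k => ((e k).2 ⟨y.1 k, y.2 k⟩).1
  symm i e h := by
    obtain ⟨h₁, h₂⟩ := le_inf_iff.1 h
    rw [le_iInf_iff] at h₂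
    refine le_inf (X.symm i _ h₁) (le_iInf fun y => S.threshold_le_himp fun hy => ?_)
    -- A tuple of `A` over the permuted base tuple is permuted back, using that `perm` is an
    -- involution.
    have hy' (k) : A.hom.toFun (y.1 (S.perm i k)) = (e k).1 := by
      rw [y.2]
      exact congrArg (fun l => (e l).1) (S.perm_perm i k)
    have h₃ := B.left.symm i _ <|
      (le_inf (h₂ ⟨_, hy'⟩) (A.left.symm i _ hy)).trans himp_inf_le
    refine h₃.trans_eq (congrArg _ (funext fun k => ?_))
    exact congrArg (fun z => ((e (S.perm i k)).2 z).1)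
      (Subtype.ext (congrArg y.1 (S.perm_perm i k)))

theorem sliceExp_ext {A B : Over X} {e e' : (sliceExp A B).carrier} (h : e.1 = e'.1)
    (h' : ∀ y hy hy', (e.2 ⟨y, hy⟩).1 = (e'.2 ⟨y, hy'⟩).1) : e = e' := by
  obtain ⟨x, φ⟩ := e
  obtain ⟨x', φ'⟩ := e'
  obtain rfl : x = x' := h
  congr 1
  exact funext fun y => Subtype.ext (h' y.1 y.2 y.2)

/-- The projection of the exponential to the base. -/
def sliceExpProj (A B : Over X) : sliceExp A B ⟶ X :=
  ⟨Sigma.fst, fun _ _ => inf_le_left⟩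

/-- The exponential as an object of the slice. -/
abbrev overExp (A B : Over X) : Over X := Over.mk (sliceExpProj A B)

/-- The evaluation morphism of the exponential. -/
def evaluation (A B : Over X) : (overFan A (overExp A B)).pt ⟶ B :=
  Over.homMk (U := (overFan A (overExp A B)).pt)
    ⟨fun p : (fibreProduct A (overExp A B)).carrier => (p.1.2.2 ⟨p.1.1, p.2⟩).1, fun i p => by
      refine (inf_le_inf_left _ (inf_le_right.trans (iInf_le _ ⟨_, fun k => (p k).2⟩))).trans ?_
      exact inf_himp_le⟩
    (hom_ext fun p : (fibreProduct A (overExp A B)).carrier =>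
      (p.1.2.2 ⟨p.1.1, p.2⟩).2.trans p.2.symm)

/-- The transpose of a morphism out of a product in the slice. -/
def transpose {A B Y : Over X} (f : (overFan A Y).pt ⟶ B) : Y ⟶ overExp A B :=
  Over.homMk
    ⟨fun y => ⟨Y.hom.toFun y, fun x => ⟨f.left.toFun ⟨(x.1, y), x.2⟩,
      (over_w f _).trans x.2⟩⟩, fun i y => by
        refine le_inf (Y.hom.rel_le i y) (le_iInf fun x => le_himp_iff.2 ?_)
        rw [inf_comm]
        exact f.left.rel_le i fun k => ⟨(x.1 k, y k), x.2 k⟩⟩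
    rfl

end Slice

variable (S) in
theorem isLocallyCartesianClosed : IsLocallyCartesianClosed (FuzzyStructure.{u} S) := fun X => by
  refine IsCartesianClosed.of_exponentials Over.mkIdTerminal overFan isLimitOverFan fun A B =>
    ⟨overExp A B, evaluation A B, fun Y f => ⟨transpose f, fun h h₁ h₂ => ?_, fun g hg => ?_⟩⟩
  · refine Over.OverMorphism.ext (hom_ext fun p => ?_)
    have hp : h.left.toFun p =
        ⟨(p.1.1, (transpose f).left.toFun p.1.2), p.2⟩ :=
      Subtype.ext (Prod.ext (congr_toFun (congrArg CommaMorphism.left h₁) p)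
        (congr_toFun (congrArg CommaMorphism.left h₂) p))
    exact congrArg (evaluation A B).left.toFun hp
  · refine Over.OverMorphism.ext (hom_ext fun y => sliceExp_ext (over_w g y) fun x hx hx' => ?_)
    -- The universal property is evaluated at the pair `(x, y)`.
    let h := (BinaryFan.IsLimit.lift' (isLimitOverFan A (overExp A B)) (overFan A Y).fst
      ((overFan A Y).snd ≫ g)).1
    exact congr_toFun (congrArg CommaMorphism.left (hg h rfl rfl)) ⟨(x, y), hx'⟩

variable (S) in
theorem isQuasitopos : IsQuasitopos (FuzzyStructure.{u} S) where
  hasFiniteLimits := inferInstance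
  hasFiniteColimits := inferInstance
  hasClassifier := nonempty_regularSubobjectClassifier S
  isLocallyCartesianClosed := isLocallyCartesianClosed S

end FuzzyStructure

/-! ### Simple fuzzy graphs as relational structures -/

/-- Adjoining a new bottom element to a frame gives a frame. -/
noncomputable instance WithBot.instFrame {α : Type*} [Order.Frame α] : Order.Frame (WithBot α) :=
  .ofMinimalAxioms
    { inf_sSup_le_iSup_inf := fun a s => by
        have hc : ∀ b ∈ s, a ⊓ b ≤ ⨆ b ∈ s, a ⊓ b := fun b hb =>
          le_iSup₂ (f := fun b (_ : b ∈ s) => a ⊓ b) b hb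
        generalize ⨆ b ∈ s, a ⊓ b = c at hc
        induction a using WithBot.recBotCoe with
        | bot => exact inf_le_left.trans bot_le
        | coe a =>
          -- The implication `a ⇨ c` is `⊥` if `c` is the adjoined bottom, and is computed in the
          -- original frame otherwise.
          induction c using WithBot.recBotCoe with
          | bot =>
            refine inf_le_right.trans (sSup_le fun b hb => ?_)
            induction b using WithBot.recBotCoe with
            | bot => exact le_rfl
            | coe b =>
              have := hc _ hb
              rw [← WithBot.coe_inf] at this
              exact absurd this (WithBot.not_coe_le_bot _)
          | coe c =>
            have : sSup s ≤ ((a ⇨ c : α) : WithBot α) := sSup_le fun b hb => by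
              induction b using WithBot.recBotCoe with
              | bot => exact bot_le
              | coe b =>
                have := hc _ hb
                rw [← WithBot.coe_inf, WithBot.coe_le_coe] at this
                exact WithBot.coe_le_coe.2 (le_himp_iff'.2 this)
            refine (inf_le_inf_left _ this).trans ?_
            rw [← WithBot.coe_inf]
            exact WithBot.coe_le_coe.2 inf_himp_le }

noncomputable instance ULift.instFrame {α : Type w₁} [Order.Frame α] :
    Order.Frame (ULift.{w₂} α) :=
  .ofMinimalAxioms
    { inf_sSup_le_iSup_inf := fun a s => by
        have hc : ∀ b ∈ s, a ⊓ b ≤ ⨆ b ∈ s, a ⊓ b := fun b hb =>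
          le_iSup₂ (f := fun b (_ : b ∈ s) => a ⊓ b) b hb
        generalize ⨆ b ∈ s, a ⊓ b = c at hc
        have : sSup s ≤ ULift.up (a.down ⇨ c.down) := sSup_le fun b hb =>
          ULift.up_le.2 (le_himp_iff'.2 (hc b hb))
        exact (inf_le_inf_left a this).trans (inf_himp_le (a := a.down) (b := c.down)) }

namespace FuzzyGraph

variable {LV : Type w₁} {LE : Type w₂} [Order.Frame LE]

/-- The truth value of adjacency of two vertices, with values in `LE` with a new bottom element
adjoined: this bottom element means that there is no edge, which differs from the presence of an
edge with membership `⊥`. The supremum has at most one term if the graph is simple. -/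
noncomputable def adjacency (A : FuzzyGraph.{w₁, w₂, u} LV LE) (x y : A.V) : WithBot LE :=
  ⨆ e : {e // A.src e = x ∧ A.tgt e = y}, (A.memE e.1 : WithBot LE)

theorem memE_le_adjacency (A : FuzzyGraph.{w₁, w₂, u} LV LE) {e : A.E} {x y : A.V}
    (hx : A.src e = x) (hy : A.tgt e = y) : (A.memE e : WithBot LE) ≤ A.adjacency x y :=
  le_iSup (fun e : {e // A.src e = x ∧ A.tgt e = y} => (A.memE e.1 : WithBot LE)) ⟨e, hx, hy⟩

variable [Order.Frame LV]

theorem IsSimple.exists_of_le_adjacency {A : FuzzyGraph.{w₁, w₂, u} LV LE} (hA : A.IsSimple)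
    {x y : A.V} {r : LE} (h : (r : WithBot LE) ≤ A.adjacency x y) :
    ∃ e, A.src e = x ∧ A.tgt e = y ∧ r ≤ A.memE e := by
  by_cases he : ∃ e, A.src e = x ∧ A.tgt e = y
  · obtain ⟨e, rfl, rfl⟩ := he
    refine ⟨e, rfl, rfl, WithBot.coe_le_coe.1 (h.trans (iSup_le fun e' => ?_))⟩
    rw [hA e'.1 e e'.2.1 e'.2.2]
  · have : IsEmpty {e // A.src e = x ∧ A.tgt e = y} := ⟨fun e => he ⟨e.1, e.2⟩⟩
    rw [adjacency, iSup_of_empty] at h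
    exact absurd h (WithBot.not_coe_le_bot r)

/-- A homomorphism into a simple graph is determined by its action on vertices. -/
theorem Hom.ext_of_isSimple {A B : FuzzyGraph.{w₁, w₂, u} LV LE} (hB : B.IsSimple)
    {f g : Hom A B} (h : ∀ x, f.onV x = g.onV x) : f = g :=
  Hom.ext (funext h) <| funext fun e => hB _ _ (by rw [f.src_onE, g.src_onE, h])
    (by rw [f.tgt_onE, g.tgt_onE, h])

theorem Hom.adjacency_le {A B : FuzzyGraph.{w₁, w₂, u} LV LE} (f : Hom A B) (x y : A.V) :
    A.adjacency x y ≤ B.adjacency (f.onV x) (f.onV y) := by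
  refine iSup_le ?_
  rintro ⟨e, rfl, rfl⟩
  exact (WithBot.coe_le_coe.2 (f.memE_le e)).trans (B.memE_le_adjacency (f.src_onE e) (f.tgt_onE e))

/-- A map of vertices which does not decrease the truth values of adjacency extends to edges. -/
noncomputable def homOfIsSimple {A B : FuzzyGraph.{w₁, w₂, u} LV LE} (hB : B.IsSimple)
    (g : A.V → B.V) (hV : ∀ x, A.memV x ≤ B.memV (g x))
    (hE : ∀ x y, A.adjacency x y ≤ B.adjacency (g x) (g y)) : Hom A B :=
  have h (e : A.E) := hB.exists_of_le_adjacency <|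
    (A.memE_le_adjacency (e := e) rfl rfl).trans (hE _ _)
  { onV := g
    onE e := (h e).choose
    src_onE e := (h e).choose_spec.1
    tgt_onE e := (h e).choose_spec.2.1
    memV_le := hV
    memE_le e := (h e).choose_spec.2.2 }

/-- The relation symbols for fuzzy graphs. -/
inductive GraphSymbol
  | vertex
  | edge

/-- The signature of simple fuzzy graphs: a unary relation for the membership of vertices, and a
binary one for adjacency. The coordinates `false` and `true` of an edge are its source and its
target. The symmetry condition imposed on adjacency is a parameter. -/
noncomputable def signature (LV : Type w₁) (LE : Type w₂) [Order.Frame LV] [Order.Frame LE]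
    (perm : Bool → Bool) (perm_perm : ∀ k, perm (perm k) = k) (t : WithBot LE)
    (ht : ∀ v, t ⊓ v = ⊥ ∨ t ≤ v) : FuzzySignature.{0, 0, max w₁ w₂} where
  Symbol := GraphSymbol
  arity
    | .vertex => Unit
    | .edge => Bool
  Value
    | .vertex => ULift.{w₂} LV
    | .edge => ULift.{w₁} (WithBot LE)
  frame
    | .vertex => inferInstanceAs (Order.Frame (ULift.{w₂} LV))
    | .edge => inferInstanceAs (Order.Frame (ULift.{w₁} (WithBot LE)))
  perm
    | .vertex => id
    | .edge => perm
  perm_perm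
    | .vertex => fun _ => rfl
    | .edge => perm_perm
  threshold
    | .vertex => (⊥ : ULift.{w₂} LV)
    | .edge => (ULift.up t : ULift.{w₁} (WithBot LE))
  threshold_inf
    | .vertex => fun _ => .inr bot_le
    | .edge => fun v => (ht v.down).imp (fun h => ULift.ext _ _ h) fun h => h

section Structure

variable {perm : Bool → Bool} {perm_perm : ∀ k, perm (perm k) = k} {t : WithBot LE}
  {ht : ∀ v, t ⊓ v = ⊥ ∨ t ≤ v}

/-- The relational structure on the vertices of a fuzzy graph. -/
noncomputable def toStructure (A : FuzzyGraph.{w₁, w₂, u} LV LE)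
    (hA : ∀ x : Bool → A.V, t ≤ A.adjacency (x false) (x true) →
      t ≤ A.adjacency (x (perm false)) (x (perm true))) :
    FuzzyStructure.{u} (signature LV LE perm perm_perm t ht) where
  carrier := A.V
  rel
    | .vertex => fun x => ULift.up (A.memV (x ()))
    | .edge => fun x => ULift.up (A.adjacency (x false) (x true))
  symm
    | .vertex => fun _ h => h
    | .edge => hA

variable {A B : FuzzyGraph.{w₁, w₂, u} LV LE}
  {hA : ∀ x : Bool → A.V, t ≤ A.adjacency (x false) (x true) →
    t ≤ A.adjacency (x (perm false)) (x (perm true))}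
  {hB : ∀ x : Bool → B.V, t ≤ B.adjacency (x false) (x true) →
    t ≤ B.adjacency (x (perm false)) (x (perm true))}

/-- A homomorphism of fuzzy graphs as a homomorphism of relational structures. -/
def Hom.toStructureHom (f : Hom A B) :
    A.toStructure (perm_perm := perm_perm) (ht := ht) hA ⟶
      B.toStructure (perm_perm := perm_perm) (ht := ht) hB where
  toFun := f.onV
  rel_le
    | .vertex => fun x => f.memV_le (x ())
    | .edge => fun x => f.adjacency_le (x false) (x true)

/-- A homomorphism of relational structures, as a homomorphism of simple fuzzy graphs. -/
noncomputable def homOfStructureHom (hBs : B.IsSimple)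
    (g : A.toStructure (perm_perm := perm_perm) (ht := ht) hA ⟶
      B.toStructure (perm_perm := perm_perm) (ht := ht) hB) : Hom A B :=
  homOfIsSimple hBs g.toFun (fun x => g.rel_le .vertex fun _ => x)
    fun x y => g.rel_le .edge fun k : Bool => cond k y x

/-- The fuzzy graph of a relational structure: its edges are the pairs of vertices for which the
truth value of adjacency is not the adjoined bottom element. -/
noncomputable def ofStructure (M : FuzzyStructure.{u} (signature LV LE perm perm_perm t ht)) :
    FuzzyGraph.{w₁, w₂, u} LV LE where
  V := M.carrier
  E := {x : Bool → M.carrier // ULift.down (M.rel .edge x) ≠ (⊥ : WithBot LE)}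
  src e := e.1 false
  tgt e := e.1 true
  memV x := ULift.down (M.rel .vertex fun _ => x)
  memE e := WithBot.unbot _ e.2

variable (M : FuzzyStructure.{u} (signature LV LE perm perm_perm t ht))

theorem isSimple_ofStructure : (ofStructure M).IsSimple := fun e e' h h' =>
  Subtype.ext <| funext fun k => by cases k <;> assumption

theorem adjacency_ofStructure (x : Bool → M.carrier) :
    (ofStructure M).adjacency (x false) (x true) = ULift.down (M.rel .edge x) := by
  refine le_antisymm (iSup_le ?_) ?_
  · rintro ⟨e, h, h'⟩
    have : e.1 = x := funext fun k => by cases k <;> assumption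
    subst this
    exact (WithBot.coe_unbot _ e.2).le
  · by_cases h : ULift.down (M.rel .edge x) = (⊥ : WithBot LE)
    · rw [h]
      exact bot_le
    · exact (WithBot.coe_unbot _ h).symm.trans_le
        (memE_le_adjacency (ofStructure M) (e := ⟨x, h⟩) rfl rfl)

/-- A relational structure is recovered from its fuzzy graph. -/
noncomputable def ofStructureIso : (ofStructure M).toStructure (fun x hx => by
    rw [adjacency_ofStructure M x] at hx
    rw [adjacency_ofStructure M fun k => x (perm k)]
    exact M.symm .edge x hx) ≅ M where
  hom :=
    { toFun := fun x => x
      rel_le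
        | .vertex => fun x => le_refl (α := LV) (M.rel .vertex x).down
        | .edge => fun x => (adjacency_ofStructure M x).le }
  inv :=
    { toFun := fun x => x
      rel_le
        | .vertex => fun x => le_refl (α := LV) (M.rel .vertex x).down
        | .edge => fun x => (adjacency_ofStructure M x).ge }

end Structure

end FuzzyGraph

/-! ### The two categories of simple fuzzy graphs -/

namespace SimpleFuzzyGraph

variable (LV : Type w₁) (LE : Type w₂) [Order.Frame LV] [Order.Frame LE]

/-- Directed simple fuzzy graphs as relational structures, without symmetry condition. -/
noncomputable def toStructures : SimpleFuzzyGraph.{w₁, w₂, u} LV LE ⥤ FuzzyStructure.{u}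
    (FuzzyGraph.signature LV LE id (fun _ => rfl) ⊥ fun _ => .inr bot_le) where
  obj A := A.obj.toStructure fun _ _ => bot_le
  map f := FuzzyGraph.Hom.toStructureHom f.hom

instance : (toStructures.{w₁, w₂, u} LV LE).IsEquivalence where
  faithful := ⟨fun {_ B} _ _ h => ObjectProperty.hom_ext _ <|
    FuzzyGraph.Hom.ext_of_isSimple B.property (FuzzyStructure.congr_toFun h)⟩
  full := ⟨fun {_ B} g => ⟨ObjectProperty.homMk (FuzzyGraph.homOfStructureHom
    (hA := fun _ _ => bot_le) (hB := fun _ _ => bot_le) B.property g), rfl⟩⟩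
  essSurj := ⟨fun M => ⟨⟨FuzzyGraph.ofStructure M, FuzzyGraph.isSimple_ofStructure M⟩,
    ⟨FuzzyGraph.ofStructureIso M⟩⟩⟩

end SimpleFuzzyGraph

namespace UndirectedSimpleFuzzyGraph

variable (LV : Type w₁) (LE : Type w₂) [Order.Frame LV] [Order.Frame LE]

/-- The signature of undirected simple fuzzy graphs: the threshold for adjacency is the least
element of `LE`, which is the atom of `WithBot LE`. The symmetry condition thus says that there is
an edge from `x` to `y` if and only if there is one from `y` to `x`, whatever the memberships. -/
noncomputable abbrev signature : FuzzySignature :=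
  FuzzyGraph.signature LV LE not Bool.not_not ((⊥ : LE) : WithBot LE) fun v => by
    induction v using WithBot.recBotCoe with
    | bot => exact .inl (inf_bot_eq _)
    | coe v => exact .inr (WithBot.coe_le_coe.2 bot_le)

variable {LV LE}

theorem adjacency_symm (A : UndirectedFuzzyGraph.{w₁, w₂, u} LV LE) (hA : A.IsSimple)
    (x : Bool → A.V) (h : ((⊥ : LE) : WithBot LE) ≤ A.adjacency (x false) (x true)) :
    ((⊥ : LE) : WithBot LE) ≤ A.adjacency (x true) (x false) := by
  obtain ⟨e, h₁, h₂, -⟩ := FuzzyGraph.IsSimple.exists_of_le_adjacency hA h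
  exact (WithBot.coe_le_coe.2 bot_le).trans (A.memE_le_adjacency (e := A.sym e)
    ((A.src_sym e).trans h₂) ((A.tgt_sym e).trans h₁))

/-- Between undirected graphs, a homomorphism of the underlying directed graphs commutes with `sym`
if the target is simple. -/
def homOfIsSimple {A B : UndirectedFuzzyGraph.{w₁, w₂, u} LV LE} (hB : B.IsSimple)
    (f : FuzzyGraph.Hom A.toFuzzyGraph B.toFuzzyGraph) : UndirectedFuzzyGraph.Hom A B where
  toHom := f
  onE_sym e := hB _ _ (by rw [f.src_onE, A.src_sym, B.src_sym, f.tgt_onE])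
    (by rw [f.tgt_onE, A.tgt_sym, B.tgt_sym, f.src_onE])

/-- The undirected fuzzy graph of a relational structure satisfying the symmetry condition. -/
noncomputable def ofStructure (M : FuzzyStructure.{u} (signature LV LE)) :
    UndirectedFuzzyGraph.{w₁, w₂, u} LV LE where
  toFuzzyGraph := FuzzyGraph.ofStructure M
  sym e := ⟨fun k => e.1 (!k), by
    have h : ((⊥ : LE) : WithBot LE) ≤ ULift.down (M.rel .edge e.1) := by
      obtain ⟨r, hr⟩ := WithBot.ne_bot_iff_exists.1 e.2
      exact (WithBot.coe_le_coe.2 bot_le).trans hr.le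
    exact fun h' => WithBot.not_coe_le_bot _ (h'.subst (M.symm .edge e.1 h))⟩
  sym_sym e := Subtype.ext <| funext fun k => congrArg e.1 (Bool.not_not k)
  src_sym _ := rfl
  tgt_sym _ := rfl

variable (LV LE)

/-- Undirected simple fuzzy graphs as relational structures. -/
noncomputable def toStructures :
    UndirectedSimpleFuzzyGraph.{w₁, w₂, u} LV LE ⥤ FuzzyStructure.{u} (signature LV LE) where
  obj A := A.obj.toStructure (adjacency_symm A.obj A.property)
  map f := f.hom.toHom.toStructureHom

instance : (toStructures.{w₁, w₂, u} LV LE).IsEquivalence where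
  faithful := ⟨fun {_ B} f g h => ObjectProperty.hom_ext _ <| UndirectedFuzzyGraph.Hom.ext
    (funext (FuzzyStructure.congr_toFun h)) <| congrArg FuzzyGraph.Hom.onE <|
      FuzzyGraph.Hom.ext_of_isSimple (f := f.hom.toHom) (g := g.hom.toHom) B.property
        (FuzzyStructure.congr_toFun h)⟩
  full := ⟨fun {A B} g => ⟨ObjectProperty.homMk
    (homOfIsSimple B.property (FuzzyGraph.homOfStructureHom
      (hA := adjacency_symm A.obj A.property) (hB := adjacency_symm B.obj B.property)
      B.property g)), rfl⟩⟩
  essSurj := ⟨fun M => ⟨⟨ofStructure M, FuzzyGraph.isSimple_ofStructure M⟩,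
    ⟨FuzzyGraph.ofStructureIso M⟩⟩⟩

end UndirectedSimpleFuzzyGraph

theorem mainTheorem3 (LV : Type w₁) (LE : Type w₂) [Order.Frame LV] [Order.Frame LE] :
    IsQuasitopos (SimpleFuzzyGraph.{w₁, w₂, u} LV LE) ∧
      IsQuasitopos (UndirectedSimpleFuzzyGraph.{w₁, w₂, u} LV LE) :=
  ⟨(FuzzyStructure.isQuasitopos _).of_equivalence
      (SimpleFuzzyGraph.toStructures LV LE).asEquivalence,
    (FuzzyStructure.isQuasitopos _).of_equivalence
      (UndirectedSimpleFuzzyGraph.toStructures LV LE).asEquivalence⟩
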